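/- **Setting.** Let $d\ge 1$. Fourier transforms are normalized as $\widehat g(\xi)=\int_{\mathbb R^d} g(x)e^{-2\pi i\langle x,\xi\rangle}\,dx$, and $\|\cdot\|$ is the Euclidean norm on $\mathbb R^d$. Let $\chi$ and a countable family $\Psi$ of functions (filters) lie in $L^1(\mathbb R^d)\cap L^2(\mathbb R^d)$ and satisfy the Littlewood–Paley condition $|\widehat\chi(\xi)|^2+\sum_{\psi\in\Psi}|\widehat\psi(\xi)|^2=1$ for a.e. $\xi$. For $f\in L^2(\mathbb R^d)$ put $$W_N(f)=\sum_{(\psi_1,\dots,\psi_N)\in\Psi^N}\big\|\,|\cdots||f*\psi_1|*\psi_2|\cdots*\psi_N|\,\big\|_2^2 .$$ **Assumption on the filters.** Let $\rho\in[0,1)$, let $\kappa\ge 2$ be an integer, and let $(r_j)_{j\in\mathbb N}$ be a strictly increasing sequence of positive reals with $\gamma:=\inf_j r_j/r_{j+\kappa}>0$. Let $\nu^*=d^{-1/2}(1,\dots,1)$ and $H^\rho=\{x\in\mathbb R^d_{\ge 0}:\langle x,\nu^*\rangle\ge(1-\rho)\|x\|\}$. Assume that $\Psi=\bigcup_j\Psi_j$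 is a partition such that for every $\psi\in\Psi_j$ there is an orthogonal matrix $A_\psi$ with $\operatorname{supp}\widehat\psi\subseteq A_\psi H^\rho\cap\{\xi: r_j\le\|\xi\|\le r_{j+\kappa}\}$. Put $$\alpha=\sqrt{1-\tfrac{4\gamma}{(1+\gamma)^2}(1-\rho)^2}.$$ **Weights and spaces.** For $k>0$, a nondecreasing $\omega:(0,\infty)\to(0,\infty)$ is a *weakly $t^k$-dominated weight* if for some $T>0$ the function $h_{k,\omega}(t)=t^k\omega^{-2}(t)$ is bounded on $(0,T)$, nondecreasing on $[T,\infty)$ and tends to $\infty$ as $t\to\infty$; it is *strongly $t^k$-dominated* if moreover $h_{k,\omega}$ is nondecreasing on $(0,\infty)$. For $\psi\in\Psi$ let $d_\psi=\inf_{\xi'\in\mathbb R^d}\sup_{\xi\in\operatorname{supp}\widehat\psi}\|\xi-\xi'\|$, and let $$\mathcal D_\omega(\Psi)=\Big\{f\in L^2(\mathbb R^d):\ \sum_{\psi\in\Psi}\omega^2(d_\psi)\,\|f*\psi\|_2^2<\infty\Big\}.$$ **Theorem.** Let $\vartheta\in L^1(\mathbb R^d)$, $\vartheta\ge 0$, be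 such that $|\widehat\vartheta|=\eta(\|\cdot\|)$ for a nonincreasing $\eta:[0,\infty)\to[0,1]$ with $\eta(0)=1$, and suppose that for some $k,C>0$ one has $1-|\widehat\vartheta(\xi)|^2\le C\|\xi\|^k$ for all $\xi\in\mathbb R^d$. Let $\omega$ be a weakly $t^k$-dominated weight. Then $\alpha\in(0,1)$, and for every $f\in\mathcal D_\omega(\Psi)$, $$W_N(f)\in\mathcal O\big(\omega^{-2}(\alpha^{-N})\big)\qquad(N\to\infty).$$ Moreover, if $\widetilde C>0$ is such that $|\widehat\vartheta(\widetilde C\xi)|\le|\widehat\chi(\xi)|$ for all $\xi$, and if $\omega$ is strongly $t^k$-dominated, then for every $f\in\mathcal D_\omega(\Psi)$ and all $N\ge 2$, $$W_N(f)\le\max\{1,\;C\,\widetilde C^{\,k}\alpha^{-2k}\}\cdot\Big(\sum_{\psi\in\Psi}\omega^2(d_\psi)\|f*\psi\|_2^2\Big)\cdot\omega^{-2}(\alpha^{-N}).$$ -/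

import Mathlib

open MeasureTheory Set Filter Topology
open scoped FourierTransform ENNReal

noncomputable section

namespace Scattering

/-- Euclidean space `ℝ^d`. -/
abbrev Rd (d : ℕ) := EuclideanSpace ℝ (Fin d)

variable {d : ℕ} {ι : Type*}

/-- The convolution `f * g`, that is `x ↦ ∫ f t * g (x - t) dt`. For `f ∈ L²` and
`g ∈ L¹ ∩ L²` the integral converges at every `x`, and `f * g` is in `L²`. -/
def conv (f g : Rd d → ℂ) : Rd d → ℂ :=
  convolution f g (ContinuousLinearMap.mul ℝ ℂ) volume

/-- The single step scattering propagator `U[g] f = |f * g|`. -/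
def step (g f : Rd d → ℂ) : Rd d → ℂ := fun x => ((‖conv f g x‖ : ℝ) : ℂ)

/-- The scattering propagator `U[p] f = |… |f * ψ_{p₁}| * … * ψ_{p_N}|` along a path of
(indices of) filters; the first entry of the path is applied first and the empty path gives
the identity. -/
def propagator (ψ : ι → Rd d → ℂ) : List ι → (Rd d → ℂ) → (Rd d → ℂ)
  | [], f => f
  | i :: p, f => propagator ψ p (step (ψ i) f)

/-- The squared `L²` norm, as a number in `[0, ∞]`. -/
def sqNorm (f : Rd d → ℂ) : ℝ≥0∞ := eLpNorm f 2 volume ^ 2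

/-- The energy remainder `W_N(f) = ∑_p ‖U[p] f‖₂²`, summed over all paths `p` of length `N`,
as a number in `[0, ∞]`. -/
def energy (ψ : ι → Rd d → ℂ) (N : ℕ) (f : Rd d → ℂ) : ℝ≥0∞ :=
  ∑' p : Fin N → ι, sqNorm (propagator ψ (List.ofFn p) f)

/-- The unit vector `ν*` all of whose entries are `1 / √d`. -/
def diagVec (d : ℕ) : Rd d := WithLp.toLp 2 (fun _ => 1 / Real.sqrt d)

/-- The closed cone `H^ρ` in the first orthant around the direction `ν*`. -/
def cone (d : ℕ) (ρ : ℝ) : Set (Rd d) :=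
  {x | (∀ k, 0 ≤ x k) ∧ (1 - ρ) * ‖x‖ ≤ inner ℝ x (diagVec d)}

/-- The closed spherical shell around `0` with inner radius `s` and outer radius `R`. -/
def shell (d : ℕ) (s R : ℝ) : Set (Rd d) := Metric.closedBall 0 R \ Metric.ball 0 s

/-- The Littlewood-Paley condition `|χ̂|² + ∑ |ψ̂ᵢ|² = 1` almost everywhere. -/
def LittlewoodPaley (χ : Rd d → ℂ) (ψ : ι → Rd d → ℂ) : Prop :=
  ∀ᵐ ξ : Rd d, ‖𝓕 χ ξ‖ₑ ^ 2 + ∑' i, ‖𝓕 (ψ i) ξ‖ₑ ^ 2 = 1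

/-- `γ = inf_j r_j / r_{j+κ}`. -/
def scaleRatio (κ : ℕ) (r : ℕ → ℝ) : ℝ := ⨅ j, r j / r (j + κ)

/-- `α(γ, ρ) = √(1 - 4 γ (1 - ρ)² / (1 + γ)²)`. -/
def rate (γ ρ : ℝ) : ℝ := Real.sqrt (1 - 4 * γ / (1 + γ) ^ 2 * (1 - ρ) ^ 2)

/-- The assumptions on the filters `χ`, `(ψ i)`: they lie in `L¹ ∩ L²`, satisfy the
Littlewood-Paley condition, and the family `(ψ i)` is partitioned into levels `j` so that the
Fourier transform of every filter of level `j` is supported in the intersection of an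
orthogonal image of the cone `H^ρ` with the shell of radii `r_j` and `r_{j+κ}`.
The scales are numbered from `0`. -/
structure LocalizedFilters (κ : ℕ) (r : ℕ → ℝ) (ρ : ℝ) (χ : Rd d → ℂ) (ψ : ι → Rd d → ℂ) :
    Prop where
  window_L1 : MemLp χ 1 volume
  window_L2 : MemLp χ 2 volume
  filter_L1 : ∀ i, MemLp (ψ i) 1 volume
  filter_L2 : ∀ i, MemLp (ψ i) 2 volume
  littlewoodPaley : LittlewoodPaley χ ψ
  two_le : 2 ≤ κ
  scale_pos : ∀ j, 0 < r j
  scale_strictMono : StrictMono r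
  scaleRatio_pos : 0 < scaleRatio κ r
  rho_nonneg : 0 ≤ ρ
  rho_lt_one : ρ < 1
  support_subset : ∃ level : ι → ℕ, ∀ i, ∃ A : Rd d ≃ₗᵢ[ℝ] Rd d,
    tsupport (𝓕 (ψ i)) ⊆ (A '' cone d ρ) ∩ shell d (r (level i)) (r (level i + κ))

/-- The Fourier transform of a real-valued function. -/
def realFourier (ϑ : Rd d → ℝ) : Rd d → ℂ := 𝓕 (fun x => (ϑ x : ℂ))

/-- `ϑ ∈ L¹` is nonnegative and `|ϑ̂|` is a radial, nonincreasing function with values in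
`[0, 1]` that is `1` at the origin. -/
structure RadialKernel (ϑ : Rd d → ℝ) : Prop where
  integrable : Integrable ϑ volume
  nonneg : ∀ᵐ x : Rd d, 0 ≤ ϑ x
  radial : ∃ η : ℝ → ℝ, AntitoneOn η (Ici 0) ∧ (∀ s ∈ Ici (0 : ℝ), η s ∈ Icc (0 : ℝ) 1) ∧
    η 0 = 1 ∧ ∀ ξ, ‖realFourier ϑ ξ‖ = η ‖ξ‖

/-- The auxiliary function `h_{k,ω}(t) = t^k ω(t)⁻²`. -/
def auxWeight (k : ℝ) (ω : ℝ → ℝ) (t : ℝ) : ℝ := t ^ k * (ω t ^ 2)⁻¹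

/-- Weakly `t^k`-dominated weights. Only the values of `ω` on `(0, ∞)` matter. -/
structure WeaklyDominated (k : ℝ) (ω : ℝ → ℝ) : Prop where
  pos : ∀ t, 0 < t → 0 < ω t
  mono : MonotoneOn ω (Ioi 0)
  aux : ∃ T : ℝ, 0 < T ∧ BddAbove (auxWeight k ω '' Ioo 0 T) ∧
    MonotoneOn (auxWeight k ω) (Ici T)
  aux_tendsto : Tendsto (auxWeight k ω) atTop atTop

/-- Strongly `t^k`-dominated weights. -/
structure StronglyDominated (k : ℝ) (ω : ℝ → ℝ) : Prop extends WeaklyDominated k ω where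
  aux_mono : MonotoneOn (auxWeight k ω) (Ioi 0)

/-- `d_ψ`, the infimum over all centres `c` of the supremum of `‖ξ - c‖` over the support of
`ψ̂`. It is used for filters with bounded Fourier support only. -/
def fourierRadius (g : Rd d → ℂ) : ℝ :=
  ⨅ c : Rd d, ⨆ ξ : tsupport (𝓕 g), ‖(ξ : Rd d) - c‖

/-- `∑_ψ ω(d_ψ)² ‖f * ψ‖₂²`, as a number in `[0, ∞]`. (A filter `ψ = 0` contributes `0`.) -/
def weightedEnergy (ω : ℝ → ℝ) (ψ : ι → Rd d → ℂ) (f : Rd d → ℂ) : ℝ≥0∞ :=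
  ∑' i, ENNReal.ofReal (ω (fourierRadius (ψ i)) ^ 2) * sqNorm (conv f (ψ i))

/-- The generalized Sobolev space `D_ω(Ψ; L²)`. -/
def sobolevSpace (ω : ℝ → ℝ) (ψ : ι → Rd d → ℂ) : Set (Rd d → ℂ) :=
  {f | MemLp f 2 volume ∧ weightedEnergy ω ψ f < ∞}

end Scattering

end

noncomputable section

namespace Scattering

variable {d : ℕ} {ι : Type*}

/-! For `θ ≥ 0` and any frequency `ν`, the triangle inequality gives `|g * (e^{2πi⟨·,ν⟩}θ)| ≤ |g| *
θ` pointwise. Subtracting the squared norms from `‖g‖²` yields, by Plancherel, `∫ (1 - |θ̂(ξ)|²)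
||g|^(ξ)|² ≤ ∫ (1 - |θ̂(ξ - ν)|²) |ĝ(ξ)|²` (`lintegral_defect_modulus_le`). Thus the modulus pushes
energy towards low frequencies, and `ν` may be chosen separately for each filter.

Cone and shell localization supplies a `ν` with `‖ξ - ν‖ ≤ α‖ξ‖` on the Fourier support of the
filter (`norm_sub_center_le`). Since the symbol is radially nondecreasing, each layer replaces its
argument `tξ` by `tαξ`, and the Littlewood–Paley condition sums the filters at no cost. Starting
from `∑|ψ̂|² ≤ K (1 - |θ̂(sξ)|²)`, induction bounds the energy at depth `n + 1` by `K ∫ (1 -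
|θ̂(sαⁿξ)|²)|f̂|²` (`energy_succ_le`).

In the layer applied first to `f`, the translate is instead a Chebyshev centre of the support of
`ψ̂`, so that the symbol is at most `min(1, C(sαⁿd_ψ)^k)` there (`energy_add_two_le`,
`lintegral_defect_mul_le`). Comparing `d_ψ` with `α^{-N}` turns this minimum into a ratio of weights
(`min_one_le_weight_ratio`). -/

/-! ### Convolution by an integrable function on L². -/

lemma sqNorm_eq_lintegral (f : Rd d → ℂ) : sqNorm f = ∫⁻ x, ‖f x‖ₑ ^ 2 := by
  have h := eLpNorm_nnreal_pow_eq_lintegral (μ := (volume : Measure (Rd d))) (f := f)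
    (p := 2) two_ne_zero
  simpa [sqNorm] using h

lemma memLp_two_of_sqNorm_lt_top {f : Rd d → ℂ} (hf : AEStronglyMeasurable f volume)
    (h : sqNorm f < ∞) : MemLp f 2 volume := by
  refine ⟨hf, lt_top_iff_ne_top.2 fun h' => ?_⟩
  simp [sqNorm, h'] at h

lemma sqNorm_lt_top {f : Rd d → ℂ} (hf : MemLp f 2 volume) : sqNorm f < ∞ :=
  ENNReal.pow_lt_top hf.eLpNorm_lt_top

/-- Cauchy–Schwarz for the splitting `f g = (f g^{1/2}) · g^{1/2}`. -/
lemma sq_lintegral_mul_le {α : Type*} [MeasurableSpace α] {μ : Measure α} {f g : α → ℝ≥0∞}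
    (hf : AEMeasurable f μ) (hg : AEMeasurable g μ) :
    (∫⁻ x, f x * g x ∂μ) ^ 2 ≤ (∫⁻ x, f x ^ 2 * g x ∂μ) * ∫⁻ x, g x ∂μ := by
  have key := ENNReal.lintegral_mul_le_Lp_mul_Lq μ Real.HolderConjugate.two_two
    (hf.mul (hg.pow_const (1 / 2 : ℝ))) (hg.pow_const (1 / 2 : ℝ))
  have e0 (x : α) : g x ^ (1 / 2 : ℝ) * g x ^ (1 / 2 : ℝ) = g x := by
    rw [← ENNReal.rpow_add_of_nonneg _ _ (by norm_num) (by norm_num)]; norm_num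
  have e1 (x : α) : (f x * g x ^ (1 / 2 : ℝ)) ^ (2 : ℝ) = f x ^ 2 * g x := by
    rw [ENNReal.rpow_two, mul_pow, sq (g x ^ _), e0]
  have e2 (x : α) : (g x ^ (1 / 2 : ℝ)) ^ (2 : ℝ) = g x := by
    rw [ENNReal.rpow_two, sq, e0]
  simp only [Pi.mul_apply, mul_assoc, e0, e1, e2] at key
  calc _ ≤ ((∫⁻ x, f x ^ 2 * g x ∂μ) ^ (1 / 2 : ℝ) * (∫⁻ x, g x ∂μ) ^ (1 / 2 : ℝ)) ^ 2 := by
        gcongr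
    _ = _ := by
        rw [mul_pow, ← ENNReal.rpow_two, ← ENNReal.rpow_two, ← ENNReal.rpow_mul,
          ← ENNReal.rpow_mul]
        norm_num

/-- The quadratic form of Young's inequality `L² * L¹ ⊆ L²` for nonnegative functions. -/
lemma lintegral_sq_lintegral_mul_sub_le {f g : Rd d → ℂ} (hf : AEStronglyMeasurable f volume)
    (hg : AEStronglyMeasurable g volume) :
    ∫⁻ x, (∫⁻ t, ‖f t‖ₑ * ‖g (x - t)‖ₑ) ^ 2 ≤ eLpNorm g 1 volume ^ 2 * sqNorm f := by
  have hgx (x : Rd d) : AEMeasurable (fun t => ‖g (x - t)‖ₑ) volume :=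
    (hg.comp_quasiMeasurePreserving (quasiMeasurePreserving_sub_left volume x)).enorm
  have hgint (x : Rd d) : ∫⁻ t, ‖g (x - t)‖ₑ = eLpNorm g 1 volume := by
    rw [eLpNorm_one_eq_lintegral_enorm]
    exact lintegral_sub_left_eq_self (fun t => ‖g t‖ₑ) x
  have hprod : AEMeasurable (fun p : Rd d × Rd d => ‖f p.2‖ₑ ^ 2 * ‖g (p.1 - p.2)‖ₑ)
      (volume.prod volume) :=
    ((hf.comp_snd (μ := (volume : Measure (Rd d)))).enorm.pow_const 2).mul
      (hg.comp_quasiMeasurePreserving (quasiMeasurePreserving_sub_of_right_invariant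
        volume volume)).enorm
  calc _ ≤ ∫⁻ x, (∫⁻ t, ‖f t‖ₑ ^ 2 * ‖g (x - t)‖ₑ) * eLpNorm g 1 volume := by
        refine lintegral_mono fun x => ?_
        rw [← hgint x]
        exact sq_lintegral_mul_le hf.enorm (hgx x)
    _ = (∫⁻ x, ∫⁻ t, ‖f t‖ₑ ^ 2 * ‖g (x - t)‖ₑ) * eLpNorm g 1 volume :=
        lintegral_mul_const'' _ hprod.lintegral_prod_right'
    _ = (∫⁻ t, ∫⁻ x, ‖f t‖ₑ ^ 2 * ‖g (x - t)‖ₑ) * eLpNorm g 1 volume := by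
        rw [lintegral_lintegral_swap hprod]
    _ = (∫⁻ t, ‖f t‖ₑ ^ 2 * eLpNorm g 1 volume) * eLpNorm g 1 volume := by
        congr 1
        refine lintegral_congr fun t => ?_
        rw [lintegral_const_mul' _ _ (by simp), eLpNorm_one_eq_lintegral_enorm]
        congr 1
        exact lintegral_sub_right_eq_self (fun x => ‖g x‖ₑ) t
    _ = _ := by
        rw [lintegral_mul_const'' _ (hf.enorm.pow_const 2), sqNorm_eq_lintegral]
        ring

lemma conv_aestronglyMeasurable {f g : Rd d → ℂ} (hf : AEStronglyMeasurable f volume)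
    (hg : AEStronglyMeasurable g volume) : AEStronglyMeasurable (conv f g) volume :=
  (hf.convolution_integrand (ContinuousLinearMap.mul ℝ ℂ) hg).integral_prod_right'

lemma conv_apply (f g : Rd d → ℂ) (x : Rd d) : conv f g x = ∫ t, f t * g (x - t) := rfl

lemma enorm_conv_le (f g : Rd d → ℂ) (x : Rd d) :
    ‖conv f g x‖ₑ ≤ ∫⁻ t, ‖f t‖ₑ * ‖g (x - t)‖ₑ := by
  rw [conv_apply]
  exact (enorm_integral_le_lintegral_enorm _).trans_eq (by simp [enorm_mul])

lemma sqNorm_conv_le {f g : Rd d → ℂ} (hf : AEStronglyMeasurable f volume)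
    (hg : AEStronglyMeasurable g volume) :
    sqNorm (conv f g) ≤ eLpNorm g 1 volume ^ 2 * sqNorm f := by
  rw [sqNorm_eq_lintegral (conv f g)]
  refine le_trans (lintegral_mono fun x => ?_) (lintegral_sq_lintegral_mul_sub_le hf hg)
  gcongr
  exact enorm_conv_le f g x

lemma memLp_conv {f g : Rd d → ℂ} (hf : MemLp f 2 volume) (hg : MemLp g 1 volume) :
    MemLp (conv f g) 2 volume :=
  memLp_two_of_sqNorm_lt_top (conv_aestronglyMeasurable hf.1 hg.1)
    ((sqNorm_conv_le hf.1 hg.1).trans_lt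
      (ENNReal.mul_lt_top (ENNReal.pow_lt_top hg.2) (sqNorm_lt_top hf)))

/-- The squared integral of the moduli has finite integral, hence is finite almost everywhere. This
is what makes convolution additive in `convL2`. -/
lemma ae_integrable_conv {f g : Rd d → ℂ} (hf : MemLp f 2 volume) (hg : MemLp g 1 volume) :
    ∀ᵐ x, Integrable (fun t => f t * g (x - t)) volume := by
  have hmeas : AEMeasurable (fun x => (∫⁻ t, ‖f t‖ₑ * ‖g (x - t)‖ₑ) ^ 2)
      (volume : Measure (Rd d)) := by
    have := (hf.1.convolution_integrand (μ := (volume : Measure (Rd d)))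
      (ContinuousLinearMap.mul ℝ ℂ) hg.1).enorm.lintegral_prod_right'
    simpa [enorm_mul] using this.pow_const 2
  have hfin : ∫⁻ x, (∫⁻ t, ‖f t‖ₑ * ‖g (x - t)‖ₑ) ^ 2 ≠ ∞ :=
    ((lintegral_sq_lintegral_mul_sub_le hf.1 hg.1).trans_lt
      (ENNReal.mul_lt_top (ENNReal.pow_lt_top hg.2) (sqNorm_lt_top hf))).ne
  filter_upwards [ae_lt_top' hmeas hfin] with x hx
  refine ⟨hf.1.convolution_integrand_snd (ContinuousLinearMap.mul ℝ ℂ) hg.1 x, ?_⟩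
  simpa [HasFiniteIntegral, enorm_mul, ENNReal.pow_lt_top_iff] using hx

lemma conv_congr {f f' g g' : Rd d → ℂ} (hf : f =ᵐ[volume] f') (hg : g =ᵐ[volume] g') :
    conv f g = conv f' g' :=
  convolution_congr _ hf hg

/-- Convolution with an integrable function as an operator on `L²`. -/
def convL2 (g : Rd d → ℂ) (hg : MemLp g 1 volume) :
    Lp ℂ 2 (volume : Measure (Rd d)) →L[ℂ] Lp ℂ 2 (volume : Measure (Rd d)) :=
  LinearMap.mkContinuous
    { toFun := fun f => (memLp_conv (Lp.memLp f) hg).toLp _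
      map_add' := fun f f' => by
        refine Lp.ext ?_
        refine (MemLp.coeFn_toLp _).trans ?_
        filter_upwards [Lp.coeFn_add ((memLp_conv (Lp.memLp f) hg).toLp _)
          ((memLp_conv (Lp.memLp f') hg).toLp _), (memLp_conv (Lp.memLp f) hg).coeFn_toLp,
          (memLp_conv (Lp.memLp f') hg).coeFn_toLp, ae_integrable_conv (Lp.memLp f) hg,
          ae_integrable_conv (Lp.memLp f') hg] with x h0 h1 h2 h3 h4
        rw [h0, Pi.add_apply, h1, h2, conv_congr (Lp.coeFn_add f f') (ae_eq_refl g),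
          conv_apply, conv_apply, conv_apply, ← integral_add h3 h4]
        simp [add_mul]
      map_smul' := fun c f => by
        refine Lp.ext ?_
        refine (MemLp.coeFn_toLp _).trans ?_
        filter_upwards [Lp.coeFn_smul c ((memLp_conv (Lp.memLp f) hg).toLp _),
          (memLp_conv (Lp.memLp f) hg).coeFn_toLp] with x h0 h1
        rw [RingHom.id_apply, h0, Pi.smul_apply, h1,
          conv_congr (Lp.coeFn_smul c f) (ae_eq_refl g), conv_apply, conv_apply,
          smul_eq_mul, ← integral_const_mul]
        simp [mul_assoc] }
    (eLpNorm g 1 volume).toReal fun f => by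
      have h : eLpNorm (conv f g) 2 volume ≤ eLpNorm g 1 volume * eLpNorm f 2 volume := by
        have := sqNorm_conv_le (Lp.memLp f).1 hg.1
        rw [sqNorm, sqNorm, ← mul_pow] at this
        exact (ENNReal.pow_le_pow_left_iff two_ne_zero).1 this
      rw [LinearMap.coe_mk, AddHom.coe_mk, Lp.norm_toLp, Lp.norm_def, ← ENNReal.toReal_mul]
      exact ENNReal.toReal_mono (ENNReal.mul_ne_top hg.2.ne (Lp.eLpNorm_ne_top f)) h

lemma coeFn_convL2 {f g : Rd d → ℂ} (hf : MemLp f 2 volume) (hg : MemLp g 1 volume) :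
    convL2 g hg (hf.toLp f) = (memLp_conv hf hg).toLp _ := by
  refine Lp.ext ?_
  refine (MemLp.coeFn_toLp (memLp_conv (Lp.memLp (hf.toLp f)) hg)).trans ?_
  rw [conv_congr hf.coeFn_toLp (ae_eq_refl g)]
  exact (MemLp.coeFn_toLp _).symm

/-! ### The Fourier transform on L¹ ∩ L² and the convolution theorem. -/

lemma continuous_fourier {g : Rd d → ℂ} (hg : Integrable g volume) : Continuous (𝓕 g) :=
  VectorFourier.fourierIntegral_continuous Real.continuous_fourierChar
    (by simpa using continuous_inner) hg

lemma norm_fourier_le (g : Rd d → ℂ) (ξ : Rd d) : ‖𝓕 g ξ‖ ≤ ∫ x, ‖g x‖ :=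
  VectorFourier.norm_fourierIntegral_le_integral_norm _ _ _ _ _

lemma integral_fourier_mul {f g : Rd d → ℂ} (hf : Integrable f volume)
    (hg : Integrable g volume) : ∫ ξ, 𝓕 f ξ * g ξ = ∫ x, f x * 𝓕 g x := by
  have := VectorFourier.integral_fourierIntegral_smul_eq_flip (L := innerₗ (Rd d))
    Real.continuous_fourierChar (by simpa using continuous_inner) hf hg
  simpa [flip_innerₗ] using! this

/-- The Fourier integral and the `L²` Fourier transform agree on `L¹ ∩ L²`. -/
lemma coeFn_fourier_toLp {h : Rd d → ℂ} (h1 : MemLp h 1 volume) (h2 : MemLp h 2 volume) :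
    (𝓕 (h2.toLp h) : Lp ℂ 2 (volume : Measure (Rd d))) =ᵐ[volume] 𝓕 h := by
  have h1' := memLp_one_iff_integrable.1 h1
  set F : Lp ℂ 2 (volume : Measure (Rd d)) := 𝓕 (h2.toLp h) with hF
  have hFl : LocallyIntegrable F volume := (Lp.memLp F).locallyIntegrable (by norm_num)
  have hcont := continuous_fourier h1'
  have := ae_eq_zero_of_integral_contDiff_smul_eq_zero (f := fun ξ => F ξ - 𝓕 h ξ)
    (μ := volume) (hFl.sub hcont.locallyIntegrable) fun g hg hgs => by
      have hg' : ContDiff ℝ ((⊤ : ℕ∞) : WithTop ℕ∞) (fun x => (g x : ℂ)) := Complex.ofRealCLM.contDiff.comp hg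
      have hgs' : HasCompactSupport (fun x => (g x : ℂ)) :=
        hgs.comp_left (g := fun x : ℝ => (x : ℂ)) Complex.ofReal_zero
      let φ : SchwartzMap (Rd d) ℂ := hgs'.toSchwartzMap hg'
      have hφ (x : Rd d) : φ x = g x := rfl
      -- Both transforms satisfy `∫ φ ĥ = ∫ φ̂ h`: one as a tempered distribution, the other by
      -- Fubini. So they agree against every test function.
      have e1 : ∫ x, φ x • F x = ∫ x, (𝓕 φ : SchwartzMap (Rd d) ℂ) x • (h2.toLp h) x := by
        rw [← Lp.toTemperedDistribution_apply, ← Lp.toTemperedDistribution_apply, hF,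
          ← Lp.fourier_toTemperedDistribution_eq, TemperedDistribution.fourier_apply]
      have e2 : ∫ x, (𝓕 φ : SchwartzMap (Rd d) ℂ) x • (h2.toLp h) x = ∫ x, φ x * 𝓕 h x := by
        rw [← integral_fourier_mul φ.integrable h1', ← SchwartzMap.fourier_coe]
        refine integral_congr_ae ?_
        filter_upwards [h2.coeFn_toLp] with x hx
        rw [hx, smul_eq_mul]
      have i1 : Integrable (fun x => g x • F x) volume :=
        hFl.integrable_smul_left_of_hasCompactSupport hg.continuous hgs
      have i2 : Integrable (fun x => g x • 𝓕 h x) volume :=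
        hcont.locallyIntegrable.integrable_smul_left_of_hasCompactSupport hg.continuous hgs
      simp only [smul_sub]
      rw [integral_sub i1 i2, sub_eq_zero]
      simpa [hφ] using e1.trans e2
  filter_upwards [this] with ξ hξ
  exact sub_eq_zero.1 hξ

lemma memLp_top_fourier {g : Rd d → ℂ} (hg : MemLp g 1 volume) : MemLp (𝓕 g) ∞ volume :=
  memLp_top_of_bound
    (continuous_fourier (memLp_one_iff_integrable.1 hg)).aestronglyMeasurable _
    (ae_of_all _ (norm_fourier_le g))

/-- The convolution theorem for `L² * L¹`. -/
lemma fourier_convL2 {g : Rd d → ℂ} (hg : MemLp g 1 volume)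
    (f : Lp ℂ 2 (volume : Measure (Rd d))) :
    (𝓕 (convL2 g hg f) : Lp ℂ 2 (volume : Measure (Rd d))) =ᵐ[volume]
      fun ξ => 𝓕 g ξ * (𝓕 f : Lp ℂ 2 (volume : Measure (Rd d))) ξ := by
  let M : Lp ℂ 2 (volume : Measure (Rd d)) →L[ℂ] Lp ℂ 2 (volume : Measure (Rd d)) :=
    ContinuousLinearMap.holderL volume ∞ 2 2 (ContinuousLinearMap.mul ℂ ℂ)
      ((memLp_top_fourier hg).toLp _)
  have hM (f : Lp ℂ 2 (volume : Measure (Rd d))) :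
      M f =ᵐ[volume] fun ξ => 𝓕 g ξ * f ξ := by
    refine (ContinuousLinearMap.coeFn_holder (r := 2) (ContinuousLinearMap.mul ℂ ℂ)
      ((memLp_top_fourier hg).toLp _) f).trans ?_
    filter_upwards [(memLp_top_fourier hg).coeFn_toLp] with ξ hξ
    rw [hξ, ContinuousLinearMap.mul_apply']
  have hc : Continuous fun f : Lp ℂ 2 (volume : Measure (Rd d)) =>
    (𝓕 f : Lp ℂ 2 (volume : Measure (Rd d))) := (Lp.fourierTransformₗᵢ (Rd d) ℂ).continuous
  -- Both sides are continuous in `f`, so it suffices to compare them on the dense subspace of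
  -- Schwartz functions.
  have key := (SchwartzMap.denseRange_toLpCLM (E := Rd d) (F := ℂ) (p := 2)
    (μ := volume) ENNReal.ofNat_ne_top).equalizer
    (g := fun f => (𝓕 (convL2 g hg f) : Lp ℂ 2 (volume : Measure (Rd d))))
    (h := fun f => M (𝓕 f)) (hc.comp (convL2 g hg).continuous) (M.continuous.comp hc) (by
      funext φ
      refine Lp.ext ((?_ : _ =ᵐ[volume] _).trans (hM _).symm)
      have hφ : MemLp φ 2 volume := φ.memLp 2 volume
      have e : convL2 g hg (SchwartzMap.toLpCLM ℝ ℂ 2 volume φ) =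
        (memLp_conv hφ hg).toLp _ := coeFn_convL2 hφ hg
      have hi : Integrable (conv φ g) volume :=
        φ.integrable.integrable_convolution _ (memLp_one_iff_integrable.1 hg)
      have hφF : (𝓕 (SchwartzMap.toLpCLM ℝ ℂ 2 volume φ) :
          Lp ℂ 2 (volume : Measure (Rd d))) = (𝓕 φ : SchwartzMap (Rd d) ℂ).toLp 2 volume :=
        SchwartzMap.toLp_fourier_eq φ
      simp only [Function.comp_apply]
      rw [e, hφF]
      refine (coeFn_fourier_toLp (memLp_one_iff_integrable.2 hi) (memLp_conv hφ hg)).trans ?_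
      filter_upwards [(𝓕 φ : SchwartzMap (Rd d) ℂ).coeFn_toLp 2 volume] with ξ hξ
      rw [hξ, mul_comm]
      exact Real.fourier_mul_convolution_eq φ.integrable (memLp_one_iff_integrable.1 hg) ξ)
  have hf : (𝓕 (convL2 g hg f) : Lp ℂ 2 (volume : Measure (Rd d))) = M (𝓕 f) :=
    congrFun key f
  rw [hf]
  exact hM _

/-! ### Power spectra and Plancherel. -/

/-- The power spectrum `|f̂|²` of a square integrable function. -/
def spectrum (f : Rd d → ℂ) (hf : MemLp f 2 volume) (ξ : Rd d) : ℝ≥0∞ :=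
  ‖(𝓕 (hf.toLp f) : Lp ℂ 2 (volume : Measure (Rd d))) ξ‖ₑ ^ 2

lemma aemeasurable_spectrum {f : Rd d → ℂ} (hf : MemLp f 2 volume) :
    AEMeasurable (spectrum f hf) volume :=
  (Lp.aestronglyMeasurable _).enorm.pow_const 2

lemma lintegral_spectrum {f : Rd d → ℂ} (hf : MemLp f 2 volume) :
    ∫⁻ ξ, spectrum f hf ξ = sqNorm f := by
  have h := Lp.norm_fourier_eq (hf.toLp f)
  rw [Lp.norm_def, Lp.norm_def, ENNReal.toReal_eq_toReal_iff' (Lp.eLpNorm_ne_top _)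
    (Lp.eLpNorm_ne_top _), eLpNorm_congr_ae hf.coeFn_toLp] at h
  rw [sqNorm, ← h]
  exact (sqNorm_eq_lintegral _).symm

lemma spectrum_conv {f g : Rd d → ℂ} (hf : MemLp f 2 volume) (hg : MemLp g 1 volume) :
    spectrum (conv f g) (memLp_conv hf hg) =ᵐ[volume]
      fun ξ => ‖𝓕 g ξ‖ₑ ^ 2 * spectrum f hf ξ := by
  filter_upwards [fourier_convL2 hg (hf.toLp f)] with ξ hξ
  rw [spectrum, spectrum, ← coeFn_convL2 hf hg, hξ, enorm_mul, mul_pow]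

lemma sqNorm_conv {f g : Rd d → ℂ} (hf : MemLp f 2 volume) (hg : MemLp g 1 volume) :
    sqNorm (conv f g) = ∫⁻ ξ, ‖𝓕 g ξ‖ₑ ^ 2 * spectrum f hf ξ := by
  rw [← lintegral_spectrum (memLp_conv hf hg), lintegral_congr_ae (spectrum_conv hf hg)]

/-! ### Modulation, dilation and modulus. -/

/-- Modulation by the frequency `ν`. -/
def modulate (ν : Rd d) (g : Rd d → ℂ) (x : Rd d) : ℂ := Real.fourierChar (inner ℝ x ν) • g x

lemma fourier_modulate (ν : Rd d) (g : Rd d → ℂ) (ξ : Rd d) :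
    𝓕 (modulate ν g) ξ = 𝓕 g (ξ - ν) := by
  rw [Real.fourier_eq, Real.fourier_eq]
  refine integral_congr_ae (ae_of_all _ fun x => ?_)
  simp only [modulate]
  rw [smul_smul, ← AddChar.map_add_eq_mul, inner_sub_right]
  congr 2
  ring

lemma norm_modulate (ν : Rd d) (g : Rd d → ℂ) (x : Rd d) : ‖modulate ν g x‖ = ‖g x‖ :=
  Circle.norm_smul _ _

lemma memLp_modulate (ν : Rd d) {g : Rd d → ℂ} (hg : MemLp g 1 volume) :
    MemLp (modulate ν g) 1 volume := by
  refine hg.of_le ?_ (ae_of_all _ fun x => (norm_modulate ν g x).le)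
  exact (Real.continuous_fourierChar.comp (by fun_prop)).aestronglyMeasurable.smul hg.1

/-- The `L¹`-normalized dilation by `s`. -/
def dilate (s : ℝ) (θ : Rd d → ℝ) (x : Rd d) : ℝ := |s ^ d|⁻¹ * θ (s⁻¹ • x)

lemma realFourier_dilate {s : ℝ} (hs : 0 < s) (θ : Rd d → ℝ) (ξ : Rd d) :
    realFourier (dilate s θ) ξ = realFourier θ (s • ξ) := by
  rw [realFourier, realFourier, Real.fourier_eq, Real.fourier_eq]
  have h := Measure.integral_comp_smul (volume : Measure (Rd d))
    (fun y : Rd d => Real.fourierChar (-inner ℝ y (s • ξ)) • ((θ y : ℝ) : ℂ)) s⁻¹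
  have e : ∫ v : Rd d, Real.fourierChar (-inner ℝ v ξ) • ((dilate s θ v : ℝ) : ℂ) =
      ∫ v : Rd d, (|s ^ d|⁻¹ : ℝ) • (Real.fourierChar (-inner ℝ (s⁻¹ • v) (s • ξ)) •
        ((θ (s⁻¹ • v) : ℝ) : ℂ)) := by
    refine integral_congr_ae (ae_of_all _ fun x => ?_)
    simp only [dilate]
    rw [real_inner_smul_left, real_inner_smul_right, inv_mul_cancel_left₀ hs.ne',
      Complex.ofReal_mul, ← Complex.real_smul, smul_comm]
  rw [e, integral_smul, h, smul_smul, finrank_euclideanSpace_fin, inv_pow, inv_inv,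
    inv_mul_cancel₀ (abs_pos.2 (pow_pos hs d).ne').ne', one_smul]

lemma integrable_dilate {s : ℝ} (hs : 0 < s) {θ : Rd d → ℝ} (hθ : Integrable θ volume) :
    Integrable (dilate s θ) volume :=
  (hθ.comp_smul (inv_ne_zero hs.ne')).const_mul _

lemma dilate_nonneg {s : ℝ} (hs : 0 < s) {θ : Rd d → ℝ} (hθ : ∀ᵐ x, 0 ≤ θ x) :
    ∀ᵐ x, 0 ≤ dilate s θ x := by
  have hq : Measure.QuasiMeasurePreserving (fun x : Rd d => s⁻¹ • x) volume volume :=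
    ⟨measurable_const_smul _, by
      rw [Measure.map_addHaar_smul _ (inv_ne_zero hs.ne')]
      exact Measure.smul_absolutelyContinuous⟩
  filter_upwards [hq.ae hθ] with x hx
  exact mul_nonneg (by positivity) hx

/-- The pointwise modulus as a complex valued function. -/
def modulus (g : Rd d → ℂ) (x : Rd d) : ℂ := ((‖g x‖ : ℝ) : ℂ)

lemma memLp_modulus {g : Rd d → ℂ} (hg : MemLp g 2 volume) : MemLp (modulus g) 2 volume :=
  hg.norm.ofReal

lemma sqNorm_modulus (g : Rd d → ℂ) : sqNorm (modulus g) = sqNorm g := by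
  simp only [sqNorm_eq_lintegral, modulus]
  refine lintegral_congr fun x => ?_
  congr 1
  exact enorm_eq_iff_norm_eq.2 (by simp)

/-- Moving the norm inside the integral erases the modulation phase, and positivity of `θ` makes
what remains exactly `|g| * θ`. -/
lemma norm_conv_modulate_le (ν : Rd d) (g : Rd d → ℂ) {θ : Rd d → ℝ} (hθ : ∀ᵐ x, 0 ≤ θ x)
    (x : Rd d) : ‖conv g (modulate ν fun y => (θ y : ℂ)) x‖ ≤
      ‖conv (modulus g) (fun y => (θ y : ℂ)) x‖ := by
  have h : conv (modulus g) (fun y => (θ y : ℂ)) x =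
      ((∫ t, ‖g t * modulate ν (fun y => (θ y : ℂ)) (x - t)‖ : ℝ) : ℂ) := by
    rw [conv_apply, ← integral_complex_ofReal]
    refine integral_congr_ae ?_
    filter_upwards [(quasiMeasurePreserving_sub_left volume x).ae hθ] with t ht
    rw [norm_mul, norm_modulate, Complex.norm_real, Real.norm_of_nonneg ht, Complex.ofReal_mul]
    rfl
  rw [h, Complex.norm_real, Real.norm_of_nonneg (integral_nonneg fun _ => norm_nonneg _),
    conv_apply]
  exact norm_integral_le_integral_norm _

/-! ### The high-pass symbol and the effect of the modulus. -/

/-- The symbol `1 - |θ̂|²`. -/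
def defect (θ : Rd d → ℝ) (ξ : Rd d) : ℝ≥0∞ := ENNReal.ofReal (1 - ‖realFourier θ ξ‖ ^ 2)

lemma defect_add {θ : Rd d → ℝ} (h : ∀ ξ, ‖realFourier θ ξ‖ ≤ 1) (ξ : Rd d) :
    defect θ ξ + ‖realFourier θ ξ‖ₑ ^ 2 = 1 := by
  rw [defect, ← ofReal_norm, ← ENNReal.ofReal_pow (norm_nonneg _),
    ← ENNReal.ofReal_add (sub_nonneg.2 (pow_le_one₀ (norm_nonneg _) (h ξ))) (by positivity)]
  simp

lemma defect_dilate {s : ℝ} (hs : 0 < s) (θ : Rd d → ℝ) (ξ : Rd d) :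
    defect (dilate s θ) ξ = defect θ (s • ξ) := by
  rw [defect, realFourier_dilate hs, defect]

lemma continuous_realFourier {θ : Rd d → ℝ} (hθ : Integrable θ volume) :
    Continuous (realFourier θ) := continuous_fourier hθ.ofReal

lemma continuous_defect {θ : Rd d → ℝ} (hθ : Integrable θ volume) : Continuous (defect θ) :=
  ENNReal.continuous_ofReal.comp
    (continuous_const.sub ((continuous_realFourier hθ).norm.pow 2))

lemma lintegral_defect_mul_add {θ : Rd d → ℝ} (hi : Integrable θ volume)
    (h1 : ∀ ξ, ‖realFourier θ ξ‖ ≤ 1) (ν : Rd d) {w : Rd d → ℝ≥0∞} (hw : AEMeasurable w volume) :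
    (∫⁻ ξ, defect θ (ξ - ν) * w ξ) + ∫⁻ ξ, ‖realFourier θ (ξ - ν)‖ₑ ^ 2 * w ξ = ∫⁻ ξ, w ξ := by
  have hc : Continuous fun ξ => defect θ (ξ - ν) :=
    (continuous_defect hi).comp (continuous_id.sub continuous_const)
  have hm : AEMeasurable (fun ξ => defect θ (ξ - ν) * w ξ) volume := hc.aemeasurable.mul hw
  rw [← lintegral_add_left' hm]
  refine lintegral_congr fun ξ => ?_
  rw [← add_mul, defect_add h1, one_mul]

/-- Taking the modulus moves energy towards the origin: the energy of `|g|` weighted by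
`1 - |θ̂|²` is at most that of `g` weighted by any translate of this symbol. -/
lemma lintegral_defect_modulus_le {θ : Rd d → ℝ} (hi : Integrable θ volume)
    (hθ : ∀ᵐ x, 0 ≤ θ x) (h1 : ∀ ξ, ‖realFourier θ ξ‖ ≤ 1) (ν : Rd d) {g : Rd d → ℂ}
    (hg : MemLp g 2 volume) :
    ∫⁻ ξ, defect θ ξ * spectrum (modulus g) (memLp_modulus hg) ξ ≤
      ∫⁻ ξ, defect θ (ξ - ν) * spectrum g hg ξ := by
  have hi' : MemLp (fun y => (θ y : ℂ)) 1 volume := memLp_one_iff_integrable.2 hi.ofReal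
  have hle : sqNorm (conv g (modulate ν fun y => (θ y : ℂ))) ≤
      sqNorm (conv (modulus g) (fun y => (θ y : ℂ))) := by
    rw [sqNorm_eq_lintegral, sqNorm_eq_lintegral]
    refine lintegral_mono fun x => ?_
    gcongr
    exact enorm_le_iff_norm_le.2 (norm_conv_modulate_le ν g hθ x)
  have a1 : (∫⁻ ξ, defect θ ξ * spectrum (modulus g) (memLp_modulus hg) ξ) +
      sqNorm (conv (modulus g) (fun y => (θ y : ℂ))) = sqNorm g := by
    rw [sqNorm_conv (memLp_modulus hg) hi', ← sqNorm_modulus g,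
      ← lintegral_spectrum (memLp_modulus hg)]
    have h := lintegral_defect_mul_add hi h1 0 (aemeasurable_spectrum (memLp_modulus hg))
    simp only [sub_zero] at h
    exact h
  have a2 : (∫⁻ ξ, defect θ (ξ - ν) * spectrum g hg ξ) +
      sqNorm (conv g (modulate ν fun y => (θ y : ℂ))) = sqNorm g := by
    rw [sqNorm_conv hg (memLp_modulate ν hi'), ← lintegral_spectrum hg]
    simp only [fourier_modulate]
    exact lintegral_defect_mul_add hi h1 ν (aemeasurable_spectrum hg)
  have hfin : sqNorm (conv g (modulate ν fun y => (θ y : ℂ))) ≠ ∞ :=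
    (sqNorm_lt_top (memLp_conv hg (memLp_modulate ν hi'))).ne
  refine (ENNReal.add_le_add_iff_right hfin).1 ?_
  rw [a2, ← a1]
  gcongr

lemma memLp_step {g f : Rd d → ℂ} (hf : MemLp f 2 volume) (hg : MemLp g 1 volume) :
    MemLp (step g f) 2 volume := memLp_modulus (memLp_conv hf hg)

/-- Scaling the symbol by `s` amounts to replacing `θ` by its dilate, which is again nonnegative and
integrable. -/
lemma lintegral_defect_step_le {θ : Rd d → ℝ} (hi : Integrable θ volume)
    (hθ : ∀ᵐ x, 0 ≤ θ x) (h1 : ∀ ξ, ‖realFourier θ ξ‖ ≤ 1) {s : ℝ} (hs : 0 < s) (ν : Rd d)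
    {f g : Rd d → ℂ} (hf : MemLp f 2 volume) (hg : MemLp g 1 volume) :
    ∫⁻ ξ, defect θ (s • ξ) * spectrum (step g f) (memLp_step hf hg) ξ ≤
      ∫⁻ ξ, defect θ (s • (ξ - ν)) * (‖𝓕 g ξ‖ₑ ^ 2 * spectrum f hf ξ) := by
  have h := lintegral_defect_modulus_le (integrable_dilate hs hi) (dilate_nonneg hs hθ)
    (fun ξ => by rw [realFourier_dilate hs]; exact h1 _) ν (memLp_conv hf hg)
  simp only [defect_dilate hs] at h
  refine h.trans_eq (lintegral_congr_ae ?_)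
  filter_upwards [spectrum_conv hf hg] with ξ hξ
  rw [hξ]

/-! ### Recursion over the layers. -/

lemma energy_zero (ψ : ι → Rd d → ℂ) (f : Rd d → ℂ) : energy ψ 0 f = sqNorm f := by
  rw [energy, tsum_eq_single default (fun b hb => absurd (Subsingleton.elim _ _) hb)]
  simp [propagator]

lemma energy_succ (ψ : ι → Rd d → ℂ) (N : ℕ) (f : Rd d → ℂ) :
    energy ψ (N + 1) f = ∑' i, energy ψ N (step (ψ i) f) := by
  rw [energy, ← (Fin.consEquiv fun _ : Fin (N + 1) => ι).tsum_eq]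
  exact (ENNReal.tsum_prod (f := fun i (p : Fin N → ι) =>
    sqNorm (propagator ψ (List.ofFn (Fin.cons i p : Fin (N + 1) → ι)) f))).trans
    (by simp [energy, propagator])

lemma tsum_lintegral_mul [Countable ι] {ψ : ι → Rd d → ℂ} (hψ : ∀ i, MemLp (ψ i) 1 volume)
    {m w : Rd d → ℝ≥0∞} (hm : Measurable m) (hw : AEMeasurable w volume) :
    ∑' i, ∫⁻ ξ, m ξ * (‖𝓕 (ψ i) ξ‖ₑ ^ 2 * w ξ) =
      ∫⁻ ξ, (∑' i, ‖𝓕 (ψ i) ξ‖ₑ ^ 2) * (m ξ * w ξ) := by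
  have hmeas (i : ι) : AEMeasurable (fun ξ => m ξ * (‖𝓕 (ψ i) ξ‖ₑ ^ 2 * w ξ)) volume :=
    hm.aemeasurable.mul (((continuous_fourier
      (memLp_one_iff_integrable.1 (hψ i))).aestronglyMeasurable.enorm.pow_const 2).mul hw)
  rw [← lintegral_tsum hmeas]
  refine lintegral_congr fun ξ => ?_
  rw [← ENNReal.tsum_mul_right]
  exact tsum_congr fun i => by ring

/-- Exponential decay in the depth of the energy remainder, in terms of a low-pass symbol. -/
lemma energy_succ_le [Countable ι] {ψ : ι → Rd d → ℂ} (hψ : ∀ i, MemLp (ψ i) 1 volume)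
    (hsum : ∀ᵐ ξ, ∑' i, ‖𝓕 (ψ i) ξ‖ₑ ^ 2 ≤ 1)
    {θ : Rd d → ℝ} (hi : Integrable θ volume) (hθ : ∀ᵐ x, 0 ≤ θ x)
    (h1 : ∀ ξ, ‖realFourier θ ξ‖ ≤ 1) {β : ℝ} (hβ : 0 < β) {ν : ι → Rd d}
    (hν : ∀ t, 0 < t → ∀ i ξ, 𝓕 (ψ i) ξ ≠ 0 →
      defect θ (t • (ξ - ν i)) ≤ defect θ ((t * β) • ξ))
    {K : ℝ≥0∞} {s : ℝ} (hs : 0 < s)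
    (hbase : ∀ᵐ ξ, ∑' i, ‖𝓕 (ψ i) ξ‖ₑ ^ 2 ≤ K * defect θ (s • ξ)) (n : ℕ) :
    ∀ (f : Rd d → ℂ) (hf : MemLp f 2 volume),
      energy ψ (n + 1) f ≤ K * ∫⁻ ξ, defect θ ((s * β ^ n) • ξ) * spectrum f hf ξ := by
  have hdm (t : ℝ) : Measurable fun ξ : Rd d => defect θ (t • ξ) :=
    ((continuous_defect hi).comp (continuous_const_smul t)).measurable
  induction n with
  | zero =>
    intro f hf
    have e := tsum_lintegral_mul hψ (m := fun _ => 1) measurable_const (aemeasurable_spectrum hf)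
    simp only [one_mul] at e
    calc energy ψ (0 + 1) f = ∑' i, sqNorm (conv f (ψ i)) := by
          rw [energy_succ]
          exact tsum_congr fun i => (energy_zero _ _).trans (sqNorm_modulus _)
      _ = ∫⁻ ξ, (∑' i, ‖𝓕 (ψ i) ξ‖ₑ ^ 2) * spectrum f hf ξ := by
          rw [← e]
          exact tsum_congr fun i => sqNorm_conv hf (hψ i)
      _ ≤ ∫⁻ ξ, K * (defect θ ((s * β ^ 0) • ξ) * spectrum f hf ξ) := by
          refine lintegral_mono_ae ?_
          filter_upwards [hbase] with ξ hξ
          rw [pow_zero, mul_one, ← mul_assoc]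
          gcongr
      _ = _ := lintegral_const_mul'' _
          ((hdm (s * β ^ 0)).aemeasurable.mul (aemeasurable_spectrum hf))
  | succ n ih =>
    intro f hf
    have hn : 0 < s * β ^ n := by positivity
    rw [energy_succ]
    calc ∑' i, energy ψ (n + 1) (step (ψ i) f)
        ≤ ∑' i, K * ∫⁻ ξ, defect θ ((s * β ^ (n + 1)) • ξ) *
            (‖𝓕 (ψ i) ξ‖ₑ ^ 2 * spectrum f hf ξ) := by
          refine ENNReal.tsum_le_tsum fun i => (ih _ (memLp_step hf (hψ i))).trans ?_
          gcongr K * ?_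
          -- The translate is the centre of filter `i`; by `hν` this gains one factor `β` in the
          -- scale.
          refine (lintegral_defect_step_le hi hθ h1 hn (ν i) hf (hψ i)).trans
            (lintegral_mono fun ξ => ?_)
          by_cases h0 : 𝓕 (ψ i) ξ = 0
          · simp [h0]
          · rw [show s * β ^ (n + 1) = s * β ^ n * β by ring]
            gcongr
            exact hν _ hn i ξ h0
      _ = K * ∫⁻ ξ, (∑' i, ‖𝓕 (ψ i) ξ‖ₑ ^ 2) *
            (defect θ ((s * β ^ (n + 1)) • ξ) * spectrum f hf ξ) := by
          rw [ENNReal.tsum_mul_left, tsum_lintegral_mul hψ (hdm _) (aemeasurable_spectrum hf)]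
      _ ≤ _ := by
          gcongr K * ?_
          refine lintegral_mono_ae ?_
          filter_upwards [hsum] with ξ hξ
          exact (mul_le_mul_left hξ _).trans_eq (one_mul _)

/-- The first layer gives up its factor `β` in exchange for free centres `c i`, which permit a bound
by the size of each support rather than by its distance from the origin. -/
lemma energy_add_two_le [Countable ι] {ψ : ι → Rd d → ℂ} (hψ : ∀ i, MemLp (ψ i) 1 volume)
    (hsum : ∀ᵐ ξ, ∑' i, ‖𝓕 (ψ i) ξ‖ₑ ^ 2 ≤ 1)
    {θ : Rd d → ℝ} (hi : Integrable θ volume) (hθ : ∀ᵐ x, 0 ≤ θ x)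
    (h1 : ∀ ξ, ‖realFourier θ ξ‖ ≤ 1) {β : ℝ} (hβ : 0 < β) {ν : ι → Rd d}
    (hν : ∀ t, 0 < t → ∀ i ξ, 𝓕 (ψ i) ξ ≠ 0 →
      defect θ (t • (ξ - ν i)) ≤ defect θ ((t * β) • ξ))
    {K : ℝ≥0∞} {s : ℝ} (hs : 0 < s)
    (hbase : ∀ᵐ ξ, ∑' i, ‖𝓕 (ψ i) ξ‖ₑ ^ 2 ≤ K * defect θ (s • ξ)) (n : ℕ) (c : ι → Rd d)
    {f : Rd d → ℂ} (hf : MemLp f 2 volume) :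
    energy ψ (n + 2) f ≤ K * ∑' i, ∫⁻ ξ, defect θ ((s * β ^ n) • (ξ - c i)) *
      (‖𝓕 (ψ i) ξ‖ₑ ^ 2 * spectrum f hf ξ) := by
  rw [energy_succ, ← ENNReal.tsum_mul_left]
  refine ENNReal.tsum_le_tsum fun i => ?_
  refine (energy_succ_le hψ hsum hi hθ h1 hβ hν hs hbase n _ (memLp_step hf (hψ i))).trans ?_
  gcongr K * ?_
  exact lintegral_defect_step_le hi hθ h1 (by positivity) (c i) hf (hψ i)

/-! ### Chebyshev centres and weights. -/

/-- The infimum is attained: for a nonempty bounded support, the supremum is 1-Lipschitz in the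
centre and tends to infinity with it. -/
lemma exists_center {g : Rd d → ℂ} (hb : Bornology.IsBounded (tsupport (𝓕 g))) :
    ∃ c : Rd d, ∀ ξ ∈ tsupport (𝓕 g), ‖ξ - c‖ ≤ fourierRadius g := by
  rcases (tsupport (𝓕 g)).eq_empty_or_nonempty with he | ⟨ξ₀, hξ₀⟩
  · exact ⟨0, by simp [he]⟩
  set S := tsupport (𝓕 g) with hS
  have : Nonempty S := ⟨⟨ξ₀, hξ₀⟩⟩
  obtain ⟨B, hB⟩ := hb.exists_norm_le
  have hbdd (c : Rd d) : BddAbove (range fun ξ : S => ‖(ξ : Rd d) - c‖) := by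
    refine ⟨B + ‖c‖, ?_⟩
    rintro _ ⟨ξ, rfl⟩
    exact (norm_sub_le _ _).trans (by gcongr; exact hB _ ξ.2)
  let F : Rd d → ℝ := fun c => ⨆ ξ : S, ‖(ξ : Rd d) - c‖
  have hle (c ξ : Rd d) (h : ξ ∈ S) : ‖ξ - c‖ ≤ F c := le_ciSup (hbdd c) ⟨ξ, h⟩
  have hF : LipschitzWith 1 F := by
    refine LipschitzWith.of_le_add fun c c' => ciSup_le fun ξ => ?_
    calc ‖(ξ : Rd d) - c‖ = ‖((ξ : Rd d) - c') + (c' - c)‖ := by congr 1; abel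
      _ ≤ F c' + dist c c' :=
        (norm_add_le _ _).trans (add_le_add (hle _ _ ξ.2) (by rw [dist_comm, dist_eq_norm]))
  have hlim : Tendsto F (cocompact (Rd d)) atTop :=
    tendsto_atTop_mono (fun c => by
      rw [dist_comm, dist_eq_norm]
      exact hle c ξ₀ hξ₀)
      (tendsto_dist_right_cocompact_atTop ξ₀)
  obtain ⟨c, hc⟩ := hF.continuous.exists_forall_le hlim
  exact ⟨c, fun ξ hξ => (hle c ξ hξ).trans (le_ciInf hc)⟩

lemma fourierRadius_nonneg (g : Rd d → ℂ) : 0 ≤ fourierRadius g :=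
  Real.iInf_nonneg fun _ => Real.iSup_nonneg fun _ => norm_nonneg _

lemma lintegral_defect_mul_le {θ : Rd d → ℝ} {k C : ℝ} (hk : 0 < k) (hC : 0 < C)
    (hkC : ∀ ξ : Rd d, 1 - ‖realFourier θ ξ‖ ^ 2 ≤ C * ‖ξ‖ ^ k)
    {t : ℝ} (ht : 0 < t) {g f : Rd d → ℂ} {c : Rd d} {D : ℝ}
    (hc : ∀ ξ ∈ tsupport (𝓕 g), ‖ξ - c‖ ≤ D) (hf : MemLp f 2 volume) (hg : MemLp g 1 volume) :
    ∫⁻ ξ, defect θ (t • (ξ - c)) * (‖𝓕 g ξ‖ₑ ^ 2 * spectrum f hf ξ) ≤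
      ENNReal.ofReal (min 1 (C * (t * D) ^ k)) * sqNorm (conv f g) := by
  rw [sqNorm_conv hf hg, ← lintegral_const_mul' _ _ ENNReal.ofReal_ne_top]
  refine lintegral_mono fun ξ => ?_
  by_cases h0 : 𝓕 g ξ = 0
  · simp [h0]
  gcongr
  refine ENNReal.ofReal_le_ofReal (le_min (by nlinarith [sq_nonneg ‖realFourier θ (t • (ξ - c))‖])
    ((hkC _).trans ?_))
  rw [norm_smul, Real.norm_of_nonneg ht.le]
  gcongr
  exact hc ξ (subset_tsupport _ h0)

/-- If `X ≤ D`, monotonicity of `ω` makes the ratio at least 1. If `D < X`, the comparison of `t^k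
ω⁻²` at `D` and `X` rearranges to `(D/X)^k ≤ ω(D)²/ω(X)²`. -/
lemma min_one_le_weight_ratio {k : ℝ} {ω : ℝ → ℝ} (hpos : ∀ t, 0 < t → 0 < ω t)
    (hmono : MonotoneOn ω (Ioi 0)) {A D X : ℝ} (hD : 0 < D) (hX : 0 < X)
    (h : D < X → auxWeight k ω D ≤ auxWeight k ω X) :
    min 1 (A * (D / X) ^ k) ≤ max 1 A * (ω D ^ 2 * (ω X ^ 2)⁻¹) := by
  have hωD := hpos D hD
  have hωX := hpos X hX
  rcases le_or_gt X D with hXD | hDX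
  · have h1 : 1 ≤ ω D ^ 2 * (ω X ^ 2)⁻¹ := by
      rw [← div_eq_mul_inv, one_le_div (by positivity)]
      exact pow_le_pow_left₀ hωX.le (hmono hX hD hXD) 2
    exact (min_le_left _ _).trans (one_le_mul_of_one_le_of_one_le (le_max_left _ _) h1)
  · have h2 : (D / X) ^ k ≤ ω D ^ 2 * (ω X ^ 2)⁻¹ := by
      have h3 := h hDX
      unfold auxWeight at h3
      rw [← div_eq_mul_inv, ← div_eq_mul_inv, div_le_div_iff₀ (by positivity) (by positivity)] at h3
      rw [Real.div_rpow hD.le hX.le, ← div_eq_mul_inv,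
        div_le_div_iff₀ (by positivity) (by positivity)]
      linarith
    exact (min_le_right _ _).trans
      (mul_le_mul (le_max_right _ _) h2 (by positivity) (by positivity))

/-- The weighted bound on the energy remainder at depth `N = n + 2`. -/
lemma energy_le_weightedEnergy [Countable ι] {ψ : ι → Rd d → ℂ}
    (hψ : ∀ i, MemLp (ψ i) 1 volume) (hsum : ∀ᵐ ξ, ∑' i, ‖𝓕 (ψ i) ξ‖ₑ ^ 2 ≤ 1)
    (hbdd : ∀ i, Bornology.IsBounded (tsupport (𝓕 (ψ i))))
    {θ : Rd d → ℝ} (hi : Integrable θ volume) (hθ : ∀ᵐ x, 0 ≤ θ x)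
    (h1 : ∀ ξ, ‖realFourier θ ξ‖ ≤ 1) {k C : ℝ} (hk : 0 < k) (hC : 0 < C)
    (hkC : ∀ ξ : Rd d, 1 - ‖realFourier θ ξ‖ ^ 2 ≤ C * ‖ξ‖ ^ k) {α : ℝ} (hα : 0 < α)
    {ν : ι → Rd d} (hν : ∀ t, 0 < t → ∀ i ξ, 𝓕 (ψ i) ξ ≠ 0 →
      defect θ (t • (ξ - ν i)) ≤ defect θ ((t * α) • ξ))
    {K : ℝ≥0∞} {s : ℝ} (hs : 0 < s)
    (hbase : ∀ᵐ ξ, ∑' i, ‖𝓕 (ψ i) ξ‖ₑ ^ 2 ≤ K * defect θ (s • ξ))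
    {ω : ℝ → ℝ} (hpos : ∀ t, 0 < t → 0 < ω t) (hmono : MonotoneOn ω (Ioi 0))
    {N : ℕ} (hN : 2 ≤ N)
    (haux : ∀ D, 0 < D → D < α ^ (-(N : ℤ)) →
      auxWeight k ω D ≤ auxWeight k ω (α ^ (-(N : ℤ))))
    {f : Rd d → ℂ} (hf : MemLp f 2 volume) :
    energy ψ N f ≤ K * (ENNReal.ofReal (max 1 (C * s ^ k * α ^ (-(2 * k)))) *
      weightedEnergy ω ψ f * ENNReal.ofReal ((ω (α ^ (-(N : ℤ))) ^ 2)⁻¹)) := by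
  obtain ⟨n, rfl⟩ := Nat.exists_eq_add_of_le' hN
  choose c hc using fun i => exists_center (hbdd i)
  refine (energy_add_two_le hψ hsum hi hθ h1 hα hν hs hbase n c hf).trans ?_
  gcongr K * ?_
  rw [weightedEnergy, ← ENNReal.tsum_mul_left, ← ENNReal.tsum_mul_right]
  refine ENNReal.tsum_le_tsum fun i => ?_
  refine (lintegral_defect_mul_le hk hC hkC (by positivity) (hc i) hf (hψ i)).trans ?_
  rw [← mul_assoc, mul_right_comm _ (sqNorm _), ← ENNReal.ofReal_mul (by positivity),
    ← ENNReal.ofReal_mul (by positivity)]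
  gcongr
  set X := α ^ (-((n + 2 : ℕ) : ℤ)) with hX
  have hXpos : 0 < X := by positivity
  -- Nothing is assumed about `ω 0`, but at radius zero the left side vanishes.
  rcases (fourierRadius_nonneg (ψ i)).eq_or_lt with h0 | hD
  · rw [← h0, mul_zero, Real.zero_rpow hk.ne', mul_zero, min_eq_right zero_le_one]
    positivity
  · have hA : C * (s * α ^ n * fourierRadius (ψ i)) ^ k =
        C * s ^ k * α ^ (-(2 * k)) * (fourierRadius (ψ i) / X) ^ k := by
      -- With `n = N - 2`, expressing `αⁿ` through `X = α^{-N}` costs `α^{-2}`, the source of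
      -- `α^{-2k}` in the constant.
      have e : s * α ^ n * fourierRadius (ψ i) = s * (α ^ (-2 : ℝ)) * (fourierRadius (ψ i) / X) := by
        rw [hX, zpow_neg, zpow_natCast, div_inv_eq_mul, Real.rpow_neg hα.le, Real.rpow_two]
        field_simp
        ring
      rw [e, Real.mul_rpow (by positivity) (by positivity), Real.mul_rpow hs.le (by positivity),
        ← Real.rpow_mul hα.le]
      ring_nf
    rw [hA, mul_assoc (max _ _)]
    exact min_one_le_weight_ratio hpos hmono hD hXpos (haux _ hD)

/-! ### Geometry of a cone inside a shell. -/

lemma norm_diagVec (hd : 1 ≤ d) : ‖diagVec d‖ = 1 := by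
  have hd' : (0 : ℝ) < d := by exact_mod_cast hd
  rw [EuclideanSpace.norm_eq]
  simp [diagVec, Real.sq_sqrt hd'.le, hd'.ne']

lemma rate_lt_one {γ ρ : ℝ} (hγ : 0 < γ) (hρ : ρ < 1) : rate γ ρ < 1 := by
  rw [rate, Real.sqrt_lt' one_pos]
  have : 0 < 4 * γ / (1 + γ) ^ 2 * (1 - ρ) ^ 2 := by
    have := sub_pos.2 hρ
    positivity
  linarith

/-- Strictness `γ < 1` matters when `ρ = 0`: there `γ = 1` would give rate 0. -/
lemma rate_pos {γ ρ : ℝ} (hγ : 0 < γ) (hγ1 : γ < 1) (hρ0 : 0 ≤ ρ) (hρ : ρ < 1) :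
    0 < rate γ ρ := by
  refine Real.sqrt_pos.2 (sub_pos.2 ?_)
  have h1 : 4 * γ / (1 + γ) ^ 2 < 1 := by
    rw [div_lt_one (by positivity)]
    nlinarith [sq_pos_of_pos (sub_pos.2 hγ1)]
  have h2 : (1 - ρ) ^ 2 ≤ 1 := pow_le_one₀ (by linarith) (by linarith)
  have h3 : 0 < 4 * γ / (1 + γ) ^ 2 := by positivity
  nlinarith [sq_nonneg (1 - ρ)]

/-- Every point of a cone intersected with a shell is closer to the centre
`2 a b (a + b)⁻¹ (1 - ρ) u` than to the origin, by the factor `rate γ ρ`. -/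
lemma norm_sub_center_le {γ ρ a b : ℝ} (hγ : 0 < γ) (hρ : ρ < 1) (ha : 0 < a) (hab : a ≤ b)
    (hγab : γ ≤ a / b) {u ξ : Rd d} (hu : ‖u‖ = 1) (hξ : (1 - ρ) * ‖ξ‖ ≤ inner ℝ ξ u)
    (haξ : a ≤ ‖ξ‖) (hξb : ‖ξ‖ ≤ b) :
    ‖ξ - (2 * a * b / (a + b) * (1 - ρ)) • u‖ ≤ rate γ ρ * ‖ξ‖ := by
  have hb : 0 < b := ha.trans_le hab
  have hσ : 0 < 1 - ρ := sub_pos.2 hρ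
  set x := ‖ξ‖ with hx
  have hx0 : 0 < x := ha.trans_le haξ
  set c := 2 * a * b / (a + b) with hc
  have hc0 : 0 < c := by positivity
  have hnorm : ‖ξ - (c * (1 - ρ)) • u‖ ^ 2 ≤ x ^ 2 - (1 - ρ) ^ 2 * (2 * c * x - c ^ 2) := by
    rw [norm_sub_sq_real, norm_smul, hu, real_inner_smul_right, mul_one, Real.norm_eq_abs, sq_abs]
    have := mul_le_mul_of_nonneg_left hξ (mul_pos hc0 hσ).le
    nlinarith
  set q := a / b with hq
  have hq0 : 0 < q := by positivity
  have hq1 : q ≤ 1 := (div_le_one hb).2 hab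
  have haq : a = q * b := by rw [hq]; field_simp
  have hγq : 4 * γ / (1 + γ) ^ 2 ≤ 4 * q / (1 + q) ^ 2 := by
    rw [div_le_div_iff₀ (by positivity) (by positivity)]
    -- This product is the factored form of the monotonicity of `4q/(1 + q)²` on `(0, 1]`.
    have : 0 ≤ (q - γ) * (1 - γ * q) := mul_nonneg (sub_nonneg.2 hγab) (by nlinarith)
    nlinarith
  have hcq : c = 2 * q / (1 + q) * b := by
    rw [hc, haq]; field_simp; ring
  -- The harmonic mean `c` of `a` and `b` makes the difference of the two sides a multiple of `(x -
  -- a)(b - x)`, so both ends of the shell are extremal.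
  have hmain : 4 * q / (1 + q) ^ 2 * x ^ 2 ≤ 2 * c * x - c ^ 2 := by
    have h0 : 0 ≤ (x - a) * (b - x) := mul_nonneg (sub_nonneg.2 haξ) (sub_nonneg.2 hξb)
    have e : 2 * c * x - c ^ 2 - 4 * q / (1 + q) ^ 2 * x ^ 2 =
        4 * q / (1 + q) ^ 2 * ((x - a) * (b - x)) := by
      rw [hcq, haq]; field_simp; ring
    have : 0 ≤ 4 * q / (1 + q) ^ 2 * ((x - a) * (b - x)) := mul_nonneg (by positivity) h0
    linarith
  have hfin : ‖ξ - (c * (1 - ρ)) • u‖ ^ 2 ≤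
      (1 - 4 * γ / (1 + γ) ^ 2 * (1 - ρ) ^ 2) * x ^ 2 := by
    have h2 := mul_le_mul_of_nonneg_right hγq (sq_nonneg x)
    have := mul_le_mul_of_nonneg_left (h2.trans hmain) (sq_nonneg (1 - ρ))
    nlinarith
  calc ‖ξ - (c * (1 - ρ)) • u‖ ≤ √((1 - 4 * γ / (1 + γ) ^ 2 * (1 - ρ) ^ 2) * x ^ 2) :=
        Real.le_sqrt_of_sq_le hfin
    _ = rate γ ρ * x := by rw [Real.sqrt_mul' _ (sq_nonneg x), Real.sqrt_sq hx0.le, rate]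

/-! ### Radial kernels. -/

lemma RadialKernel.norm_le_one {θ : Rd d → ℝ} (h : RadialKernel θ) (ξ : Rd d) :
    ‖realFourier θ ξ‖ ≤ 1 := by
  obtain ⟨η, -, h1, -, h2⟩ := h.radial
  rw [h2]
  exact (h1 _ (norm_nonneg ξ)).2

lemma RadialKernel.norm_anti {θ : Rd d → ℝ} (h : RadialKernel θ) {ξ ξ' : Rd d}
    (hle : ‖ξ‖ ≤ ‖ξ'‖) : ‖realFourier θ ξ'‖ ≤ ‖realFourier θ ξ‖ := by
  obtain ⟨η, h0, -, -, h2⟩ := h.radial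
  rw [h2, h2]
  exact h0 (norm_nonneg ξ) (norm_nonneg ξ') hle

lemma defect_le_defect {θ : Rd d → ℝ} {ξ ξ' : Rd d}
    (h : ‖realFourier θ ξ'‖ ≤ ‖realFourier θ ξ‖) : defect θ ξ ≤ defect θ ξ' := by
  unfold defect
  gcongr

/-- By Riemann–Lebesgue `|θ̂| < 1/2` at a far point of one ray; radial monotonicity extends this, as
`≤ 1/2`, to all frequencies at least as far out. -/
lemma RadialKernel.exists_scale (hd : 1 ≤ d) {θ : Rd d → ℝ} (h : RadialKernel θ) {R : ℝ}
    (hR : 0 < R) : ∃ s : ℝ, 0 < s ∧ ∀ ξ : Rd d, R ≤ ‖ξ‖ → 1 ≤ 2 * defect θ (s • ξ) := by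
  have hlim : Tendsto (realFourier θ) (cocompact (Rd d)) (𝓝 0) := by
    have := tendsto_integral_exp_inner_smul_cocompact (V := Rd d) (fun x => (θ x : ℂ))
    exact this.congr fun ξ => (Real.fourier_eq _ ξ).symm
  have hray : Tendsto (fun s : ℝ => (s * R) • diagVec d) atTop (cocompact (Rd d)) := by
    refine tendsto_cocompact_of_tendsto_dist_comp_atTop 0 ?_
    refine tendsto_atTop_mono (fun s => ?_) (tendsto_id.atTop_mul_const hR)
    rw [dist_zero_right, norm_smul, norm_diagVec hd, mul_one]
    exact le_abs_self _
  have hev := (hlim.comp hray).norm.eventually (gt_mem_nhds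
    (show ‖(0 : ℂ)‖ < 1 / 2 by norm_num))
  obtain ⟨s, hs, hs0⟩ := (hev.and (eventually_gt_atTop 0)).exists
  refine ⟨s, hs0, fun ξ hξ => ?_⟩
  have h1 : ‖realFourier θ (s • ξ)‖ ≤ 1 / 2 := by
    refine (h.norm_anti ?_).trans hs.le
    rw [norm_smul, norm_smul, norm_diagVec hd, mul_one, norm_mul, Real.norm_of_nonneg hR.le]
    gcongr
  have h2 : 1 / 2 ≤ 1 - ‖realFourier θ (s • ξ)‖ ^ 2 := by
    nlinarith [norm_nonneg (realFourier θ (s • ξ))]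
  calc (1 : ℝ≥0∞) = ENNReal.ofReal (2 * (1 / 2)) := by norm_num
    _ = 2 * ENNReal.ofReal (1 / 2) := by
      rw [ENNReal.ofReal_mul (by norm_num)]; norm_num
    _ ≤ _ := by unfold defect; gcongr

/-! ### Consequences of the filter assumptions. -/

namespace LocalizedFilters

variable {κ : ℕ} {r : ℕ → ℝ} {ρ : ℝ} {χ : Rd d → ℂ} {ψ : ι → Rd d → ℂ}

lemma scaleRatio_le (h : LocalizedFilters κ r ρ χ ψ) (j : ℕ) :
    scaleRatio κ r ≤ r j / r (j + κ) :=
  ciInf_le ⟨0, by rintro _ ⟨j, rfl⟩; exact (div_pos (h.scale_pos _) (h.scale_pos _)).le⟩ j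

lemma scaleRatio_lt_one (h : LocalizedFilters κ r ρ χ ψ) : scaleRatio κ r < 1 := by
  refine (h.scaleRatio_le 0).trans_lt ((div_lt_one (h.scale_pos _)).2 (h.scale_strictMono ?_))
  have := h.two_le
  omega

lemma rate_mem (h : LocalizedFilters κ r ρ χ ψ) :
    0 < rate (scaleRatio κ r) ρ ∧ rate (scaleRatio κ r) ρ < 1 :=
  ⟨rate_pos h.scaleRatio_pos h.scaleRatio_lt_one h.rho_nonneg h.rho_lt_one,
    rate_lt_one h.scaleRatio_pos h.rho_lt_one⟩

lemma isBounded (h : LocalizedFilters κ r ρ χ ψ) (i : ι) :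
    Bornology.IsBounded (tsupport (𝓕 (ψ i))) := by
  obtain ⟨level, hl⟩ := h.support_subset
  obtain ⟨A, hA⟩ := hl i
  exact Metric.isBounded_closedBall.subset (hA.trans (inter_subset_right.trans sdiff_subset))

lemma le_norm_of_ne_zero (h : LocalizedFilters κ r ρ χ ψ) {i : ι} {ξ : Rd d}
    (hξ : 𝓕 (ψ i) ξ ≠ 0) : r 0 ≤ ‖ξ‖ := by
  obtain ⟨level, hl⟩ := h.support_subset
  obtain ⟨A, hA⟩ := hl i
  have := (hA (subset_tsupport _ hξ)).2.2
  rw [mem_ball_zero_iff, not_lt] at this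
  exact (h.scale_strictMono.monotone (Nat.zero_le _)).trans this

lemma exists_centers (hd : 1 ≤ d) (h : LocalizedFilters κ r ρ χ ψ) :
    ∃ ν : ι → Rd d, ∀ i ξ, 𝓕 (ψ i) ξ ≠ 0 → ‖ξ - ν i‖ ≤ rate (scaleRatio κ r) ρ * ‖ξ‖ := by
  obtain ⟨level, hl⟩ := h.support_subset
  choose A hA using hl
  refine ⟨fun i => (2 * r (level i) * r (level i + κ) / (r (level i) + r (level i + κ)) *
    (1 - ρ)) • A i (diagVec d), fun i ξ hξ => ?_⟩
  obtain ⟨⟨y, hy, rfl⟩, hb, ha⟩ := hA i (subset_tsupport _ hξ)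
  rw [mem_ball_zero_iff, not_lt] at ha
  rw [mem_closedBall_zero_iff] at hb
  refine norm_sub_center_le h.scaleRatio_pos h.rho_lt_one (h.scale_pos _)
    (h.scale_strictMono.monotone (Nat.le_add_right _ _)) (h.scaleRatio_le _) ?_ ?_ ha hb
  · rw [LinearIsometryEquiv.norm_map, norm_diagVec hd]
  · rw [LinearIsometryEquiv.norm_map, LinearIsometryEquiv.inner_map_map]
    exact hy.2

lemma tsum_le_one (h : LocalizedFilters κ r ρ χ ψ) :
    ∀ᵐ ξ, ∑' i, ‖𝓕 (ψ i) ξ‖ₑ ^ 2 ≤ 1 := by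
  filter_upwards [h.littlewoodPaley] with ξ hξ
  exact le_add_self.trans_eq hξ

/-- Base case without a condition on `χ`: every `ψ̂` vanishes on `‖ξ‖ < r 0`, and elsewhere the sum
is at most 1. -/
lemma tsum_le_two_mul_defect (h : LocalizedFilters κ r ρ χ ψ) {θ : Rd d → ℝ} {s : ℝ}
    (hs : ∀ ξ : Rd d, r 0 ≤ ‖ξ‖ → 1 ≤ 2 * defect θ (s • ξ)) :
    ∀ᵐ ξ, ∑' i, ‖𝓕 (ψ i) ξ‖ₑ ^ 2 ≤ 2 * defect θ (s • ξ) := by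
  filter_upwards [h.tsum_le_one] with ξ hξ
  by_cases h0 : r 0 ≤ ‖ξ‖
  · exact hξ.trans (hs ξ h0)
  · have (i : ι) : 𝓕 (ψ i) ξ = 0 := by
      by_contra hne
      exact h0 (h.le_norm_of_ne_zero hne)
    simp [this]

/-- Base case with constant 1: the sum is `1 - |χ̂|²`, and `|χ̂|` dominates the scaled `|θ̂|`. -/
lemma tsum_le_defect (h : LocalizedFilters κ r ρ χ ψ) {θ : Rd d → ℝ}
    (h1 : ∀ ξ, ‖realFourier θ ξ‖ ≤ 1) {s : ℝ}
    (hs : ∀ ξ : Rd d, ‖realFourier θ (s • ξ)‖ ≤ ‖𝓕 χ ξ‖) :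
    ∀ᵐ ξ, ∑' i, ‖𝓕 (ψ i) ξ‖ₑ ^ 2 ≤ 1 * defect θ (s • ξ) := by
  filter_upwards [h.littlewoodPaley] with ξ hξ
  have hle : ‖realFourier θ (s • ξ)‖ₑ ^ 2 ≤ ‖𝓕 χ ξ‖ₑ ^ 2 := by
    gcongr
    exact enorm_le_iff_norm_le.2 (hs ξ)
  rw [one_mul]
  refine (ENNReal.add_le_add_iff_right
    (a := ‖realFourier θ (s • ξ)‖ₑ ^ 2) (by simp)).1 ?_
  rw [defect_add h1, ← hξ, add_comm]
  gcongr

end LocalizedFilters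

/-- The comparison of auxiliary weights needed for the decay estimate holds at every large
argument. -/
lemma WeaklyDominated.eventually_aux_le {k : ℝ} {ω : ℝ → ℝ} (h : WeaklyDominated k ω) :
    ∀ᶠ X in atTop, ∀ D, 0 < D → D < X → auxWeight k ω D ≤ auxWeight k ω X := by
  obtain ⟨T, hT, ⟨B, hB⟩, hm⟩ := h.aux
  filter_upwards [eventually_ge_atTop T, h.aux_tendsto.eventually_ge_atTop B] with X hX hBX D hD hDX
  rcases lt_or_ge D T with hDT | hTD
  · exact (hB ⟨D, ⟨hD, hDT⟩, rfl⟩).trans hBX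
  · exact hm hTD hX hDX.le

end Scattering

end

/-! ### The decay theorem. -/

theorem mainTheorem6 {d : ℕ} (hd : 1 ≤ d) {ι : Type*} [Countable ι]
    (χ : Scattering.Rd d → ℂ) (ψ : ι → Scattering.Rd d → ℂ)
    (κ : ℕ) (r : ℕ → ℝ) (ρ : ℝ)
    (hfilters : Scattering.LocalizedFilters κ r ρ χ ψ)
    (ϑ : Scattering.Rd d → ℝ) (hϑ : Scattering.RadialKernel ϑ)
    (k C : ℝ) (hk : 0 < k) (hC : 0 < C)
    (hkC : ∀ ξ : Scattering.Rd d, 1 - ‖Scattering.realFourier ϑ ξ‖ ^ 2 ≤ C * ‖ξ‖ ^ k)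
    (ω : ℝ → ℝ) (hω : Scattering.WeaklyDominated k ω)
    (α : ℝ) (hα : α = Scattering.rate (Scattering.scaleRatio κ r) ρ) :
    (0 < α ∧ α < 1) ∧
    (∀ f ∈ Scattering.sobolevSpace ω ψ, ∃ K : ℝ, 0 < K ∧ ∃ N₀ : ℕ, ∀ N : ℕ, N₀ ≤ N →
      Scattering.energy ψ N f ≤ ENNReal.ofReal (K * (ω (α ^ (-(N : ℤ))) ^ 2)⁻¹)) ∧
    (∀ C' : ℝ, 0 < C' →
      (∀ ξ : Scattering.Rd d, ‖Scattering.realFourier ϑ (C' • ξ)‖ ≤ ‖𝓕 χ ξ‖) →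
      Scattering.StronglyDominated k ω →
      ∀ f ∈ Scattering.sobolevSpace ω ψ, ∀ N : ℕ, 2 ≤ N →
        Scattering.energy ψ N f ≤
          ENNReal.ofReal (max 1 (C * C' ^ k * α ^ (-(2 * k)))) *
            Scattering.weightedEnergy ω ψ f *
              ENNReal.ofReal ((ω (α ^ (-(N : ℤ))) ^ 2)⁻¹)) := by
  have hα01 : 0 < α ∧ α < 1 := hα ▸ hfilters.rate_mem
  obtain ⟨ν, hν⟩ := hfilters.exists_centers hd
  rw [← hα] at hν
  have hν' : ∀ t, 0 < t → ∀ i ξ, 𝓕 (ψ i) ξ ≠ 0 →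
      Scattering.defect ϑ (t • (ξ - ν i)) ≤ Scattering.defect ϑ ((t * α) • ξ) :=
    fun t ht i ξ h0 => Scattering.defect_le_defect (hϑ.norm_anti (by
      rw [norm_smul, norm_smul, norm_mul, mul_assoc, Real.norm_of_nonneg hα01.1.le]
      gcongr
      exact hν i ξ h0))
  -- `K` and `s` stay free: the asymptotic bound uses `K = 2` and the Riemann–Lebesgue scale, the
  -- explicit one `K = 1` and `s = C'`.
  have hbound := fun (K : ℝ≥0∞) (s : ℝ) (hs : 0 < s) hbase (N : ℕ) (hN : 2 ≤ N) =>
    Scattering.energy_le_weightedEnergy (K := K) hfilters.filter_L1 hfilters.tsum_le_one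
      hfilters.isBounded hϑ.integrable hϑ.nonneg hϑ.norm_le_one hk hC hkC hα01.1 hν' hs hbase
      hω.pos hω.mono hN
  refine ⟨hα01, fun f hf => ?_, fun C' hC' hχ hω' f hf N hN => ?_⟩
  · obtain ⟨s, hs, hs'⟩ := hϑ.exists_scale hd (hfilters.scale_pos 0)
    have hlim : Tendsto (fun N : ℕ => α ^ (-(N : ℤ))) atTop atTop := by
      simpa [zpow_neg, inv_pow] using
        tendsto_pow_atTop_atTop_of_one_lt ((one_lt_inv₀ hα01.1).2 hα01.2)
    obtain ⟨N₀, hN₀⟩ := eventually_atTop.1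
      ((hlim.eventually hω.eventually_aux_le).and (eventually_ge_atTop 2))
    set M : ℝ := max 1 (C * s ^ k * α ^ (-(2 * k))) with hM
    have hM1 : 1 ≤ M := le_max_left _ _
    set w : ℝ := (Scattering.weightedEnergy ω ψ f).toReal with hw
    have hw0 : 0 ≤ w := ENNReal.toReal_nonneg
    -- The summand 1 keeps the constant positive when the weighted energy is zero.
    refine ⟨2 * (M * w) + 1, by positivity, N₀, fun N hN => ?_⟩
    refine (hbound 2 s hs (hfilters.tsum_le_two_mul_defect hs') N (hN₀ N hN).2 (hN₀ N hN).1
      hf.1).trans ?_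
    rw [← ENNReal.ofReal_toReal hf.2.ne, ← hw, ← hM, ← ENNReal.ofReal_mul (by positivity),
      ← ENNReal.ofReal_mul (by positivity),
      show (2 : ℝ≥0∞) = ENNReal.ofReal 2 by norm_num, ← ENNReal.ofReal_mul (by norm_num)]
    refine ENNReal.ofReal_le_ofReal ?_
    rw [← mul_assoc]
    gcongr
    linarith
  · refine (hbound 1 C' hC' (hfilters.tsum_le_defect hϑ.norm_le_one hχ) N hN
      (fun D hD hDX => hω'.aux_mono hD (hD.trans hDX) hDX.le) hf.1).trans_eq ?_
    rw [one_mul]
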